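/- Let $\zeta$ be the Riemann zeta function, let $\psi=\Gamma'/\Gamma$ be the digamma function, and let $\gamma_0$ be the Euler–Mascheroni constant; $\zeta$ and $\psi$ are real-valued on $(0,1)$. Put $F(s)=\zeta(s)-\psi(1-s)$ for $0<s<1$, $b'=\gamma_0+\tfrac12$ and $b=\gamma_0-\tfrac12$. Then for all $0<s<1$, $$s<F(s)<b's+b.$$ The line $b's+b$ is the best possible linear upper bound for $F$ on $(0,1)$: if $m',c'\in\mathbb R$ satisfy $F(s)\le m's+c'$ for all $s\in(0,1)$, then $b's+b\le m's+c'$ for all $s\in(0,1)$. Moreover, for all $0<s<1$, $\psi(1-s)-\psi(s)=\pi\cot(\pi s)$, and Henry's conjectured inequality $$\pi\cot(\pi s)+s<\zeta(s)-\psi(s)<\pi\cot(\pi s)+b's+b$$ holds. -/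

import Mathlib

open Set

namespace HenryZeta

noncomputable section

/-- The Riemann zeta function on the real line, as the real part of Mathlib's complex function.
That `ζ(s)` is real for `0 < s < 1` is part of the theorem. -/
def zetaReal (s : ℝ) : ℝ := (riemannZeta (s : ℂ)).re

/-- The digamma function `ψ = Γ' / Γ` on the real line, as the real part of Mathlib's complex
function. That `ψ(s)` is real for `0 < s < 1` is part of the theorem. -/
def digammaReal (s : ℝ) : ℝ := (Complex.digamma (s : ℂ)).re

/-- `F(s) = ζ(s) - ψ(1 - s)`. -/
def F (s : ℝ) : ℝ := zetaReal s - digammaReal (1 - s)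

/-- `b' = γ₀ + 1/2`, where `γ₀` is the Euler–Mascheroni constant. -/
def slope : ℝ := Real.eulerMascheroniConstant + 1 / 2

/-- `b = γ₀ - 1/2`, where `γ₀` is the Euler–Mascheroni constant. -/
def intercept : ℝ := Real.eulerMascheroniConstant - 1 / 2

/-- The line `m s + c` is the best possible linear upper bound for `f` on the set `S`: it is an
upper bound for `f` on `S`, and it lies below every linear upper bound for `f` on `S`. -/
def IsBestLinearUpperBound (f : ℝ → ℝ) (S : Set ℝ) (m c : ℝ) : Prop :=
  (∀ s ∈ S, f s ≤ m * s + c) ∧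
    ∀ m' c' : ℝ, (∀ s ∈ S, f s ≤ m' * s + c') → ∀ s ∈ S, m * s + c ≤ m' * s + c'

end

end HenryZeta

/-!
Since `ψ(1 - s) = ψ(2 - s) - 1 / (1 - s)`, the pole of `ζ` at `1` cancels that of `ψ`:
`F(s) = (ζ(s) + 1 / (1 - s)) - ψ(2 - s)` extends continuously to `[0, 1]`, with values `γ - 1/2` at
`0` and `2γ` at `1`. The line `b' s + b` is the chord through these two endpoints, so it is the best
possible linear upper bound as soon as it is an upper bound at all.

Both summands are limits of finite sums. The function `ζ(s) + 1 / (1 - s) - 1 / 2` is the sum of the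
trapezoidal errors of `x ^ (-s)` on the intervals `[n, n + 1]` (`tendsto_sum_trapError`). It comes
from the Dirichlet series by the identity theorem. And `-ψ(2 - s)` is the limit of
`∑ 1 / (n + 1 - s) - log (N + 1)` (`tendsto_sum_one_div_sub_log`), because convexity of `log Γ`
traps `ψ(x + N)` between logarithms.

*Upper bound.* Against the chord in `s`, each trapezoidal error exceeds by at most
`s (1 - s) / 4 * (1 / n - 1 / (n + 1))` (`trapError_le`), which sums to `s (1 - s) / 4`, whereas the
convexity of `1 / x` puts `-ψ(2 - s)` below its chord by at least `s (1 - s) (1 / 4 + 1 / 18)`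
(`neg_digammaReal_two_sub_le`). So `F` is strictly below its chord.

*Lower bound.* The minimum of `F(s) - s` is only about `0.003`, near `s = 1 / 2`, so sharp estimates
are needed. Euler–Maclaurin summation with a signed remainder gives
`ζ(s) + 1 / (1 - s) ≥ 1 / 2 + s / 12 - s (s + 1) (s + 2) / 720` (`le_zetaReal`), and `-ψ(2 - s)` is
bounded below by a quadratic expansion around `s = 1 / 2` (`le_neg_digammaReal_two_sub`). What
remains is a polynomial inequality (`lt_F`).

Henry's inequality is the two-sided bound for `F` combined with the reflection formula for `ψ`.
-/

namespace HenryZeta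

open Filter Topology

/-! ### The zeta function on `(0, 1)` as a limit of finite sums -/

/-- The `n`-th term of the series for `(1 - s) ζ(s) + 1`: the left-endpoint rectangle error
for `x ↦ x ^ (-s)` on `[n + 1, n + 2]`, multiplied by `1 - s` so as to be entire in `s`. -/
noncomputable def rectTerm (n : ℕ) (s : ℂ) : ℂ :=
  (1 - s) * ((n + 1 : ℝ) : ℂ) ^ (-s) - (((n + 2 : ℝ) : ℂ) ^ (1 - s) - ((n + 1 : ℝ) : ℂ) ^ (1 - s))

lemma norm_cpow_neg_sub_cpow_neg_le {a x : ℝ} (ha : 0 < a) (hx : a ≤ x) {s : ℂ} (hs : 0 < s.re) :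
    ‖(x : ℂ) ^ (-s) - (a : ℂ) ^ (-s)‖ ≤ ‖s‖ * a ^ (-s.re - 1) * (x - a) := by
  have hs0 : -s ≠ 0 := by
    intro h; rw [neg_eq_zero] at h; simp [h] at hs
  have := (convex_Icc a x).norm_image_sub_le_of_norm_hasDerivWithin_le
    (f := fun y : ℝ ↦ (y : ℂ) ^ (-s)) (C := ‖s‖ * a ^ (-s.re - 1))
    (fun y hy ↦ (hasDerivAt_ofReal_cpow_const (ha.trans_le hy.1).ne' hs0).hasDerivWithinAt)
    (fun y hy ↦ ?_) (left_mem_Icc.2 hx) (right_mem_Icc.2 hx)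
  · rwa [Real.norm_of_nonneg (sub_nonneg.2 hx)] at this
  · have hy0 := ha.trans_le hy.1
    rw [norm_mul, norm_neg, Complex.norm_cpow_eq_rpow_re_of_pos hy0]
    gcongr
    simpa using Real.rpow_le_rpow_of_nonpos ha hy.1 (by simp; linarith : (-s - 1).re ≤ 0)

lemma norm_rectTerm_le (n : ℕ) {s : ℂ} (hs : 0 < s.re) (hs1 : s ≠ 1) :
    ‖rectTerm n s‖ ≤ ‖1 - s‖ * ‖s‖ * ((n + 1 : ℝ)) ^ (-s.re - 1) := by
  set a : ℝ := n + 1 with ha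
  have ha0 : 0 < a := by positivity
  have h1 : 1 - s ≠ 0 := sub_ne_zero.2 hs1.symm
  have := (convex_Icc a (a + 1)).norm_image_sub_le_of_norm_hasDerivWithin_le
    (f := fun y : ℝ ↦ (1 - s) * (a : ℂ) ^ (-s) * y - (y : ℂ) ^ (1 - s))
    (f' := fun y ↦ (1 - s) * (a : ℂ) ^ (-s) - (1 - s) * (y : ℂ) ^ (1 - s - 1))
    (C := ‖1 - s‖ * ‖s‖ * a ^ (-s.re - 1))
    (fun y hy ↦ ?_) (fun y hy ↦ ?_) (left_mem_Icc.2 (by linarith)) (right_mem_Icc.2 (by linarith))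
  · rw [add_sub_cancel_left, norm_one, mul_one] at this
    have key : rectTerm n s = (1 - s) * (a : ℂ) ^ (-s) * ((a + 1 : ℝ) : ℂ)
        - ((a + 1 : ℝ) : ℂ) ^ (1 - s) - ((1 - s) * (a : ℂ) ^ (-s) * a - (a : ℂ) ^ (1 - s)) := by
      rw [rectTerm, show (n + 2 : ℝ) = a + 1 by rw [ha]; ring, ← ha]
      push_cast
      ring
    rwa [key]
  · have := (((hasDerivAt_id y).ofReal_comp.const_mul ((1 - s) * (a : ℂ) ^ (-s))).sub
      (hasDerivAt_ofReal_cpow_const (ha0.trans_le hy.1).ne' h1))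
    simp only [Complex.ofReal_one, mul_one] at this
    exact this.hasDerivWithinAt
  · rw [← mul_sub, norm_mul, mul_assoc, show 1 - s - 1 = -s by ring,
      norm_sub_rev ((a : ℂ) ^ (-s))]
    gcongr
    refine (norm_cpow_neg_sub_cpow_neg_le ha0 hy.1 hs).trans ?_
    exact mul_le_of_le_one_right (by positivity) (by linarith [hy.2])

lemma differentiable_rectTerm (n : ℕ) : Differentiable ℂ (rectTerm n) := by
  have h1 : ((n + 1 : ℝ) : ℂ) ≠ 0 := by exact_mod_cast (by positivity : (n + 1 : ℝ) ≠ 0)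
  have h2 : ((n + 2 : ℝ) : ℂ) ≠ 0 := by exact_mod_cast (by positivity : (n + 2 : ℝ) ≠ 0)
  unfold rectTerm
  intro s
  exact ((by fun_prop : DifferentiableAt ℂ (fun s : ℂ ↦ 1 - s) s).mul
    ((by fun_prop : DifferentiableAt ℂ (fun s : ℂ ↦ -s) s).const_cpow (Or.inl h1))).sub
    (((by fun_prop : DifferentiableAt ℂ (fun s : ℂ ↦ 1 - s) s).const_cpow (Or.inl h2)).sub
    ((by fun_prop : DifferentiableAt ℂ (fun s : ℂ ↦ 1 - s) s).const_cpow (Or.inl h1)))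

lemma sum_rectTerm (N : ℕ) (s : ℂ) :
    ∑ n ∈ Finset.range N, rectTerm n s =
      (1 - s) * ∑ n ∈ Finset.range N, ((n + 1 : ℝ) : ℂ) ^ (-s) - ((N + 1 : ℝ) : ℂ) ^ (1 - s) + 1 := by
  induction N with
  | zero => simp
  | succ N ih =>
    rw [Finset.sum_range_succ, Finset.sum_range_succ, ih, rectTerm]
    push_cast
    rw [show (N : ℂ) + 1 + 1 = N + 2 by ring]
    ring

lemma summable_rpow_succ {σ : ℝ} (hσ : 0 < σ) : Summable fun n : ℕ ↦ (n + 1 : ℝ) ^ (-σ - 1) := by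
  have := (summable_nat_add_iff 1).2 (Real.summable_nat_rpow.2 (by linarith : -σ - 1 < -1))
  simpa using this

lemma hasSum_rectTerm_of_one_lt {s : ℂ} (hs : 1 < s.re) :
    HasSum (fun n ↦ rectTerm n s) (1 - riemannZeta₁ s) := by
  have hs1 : s ≠ 1 := by rintro rfl; simp at hs
  have hsum : Summable fun n ↦ rectTerm n s :=
    .of_norm_bounded ((summable_rpow_succ (by linarith : 0 < s.re)).mul_left (‖1 - s‖ * ‖s‖))
      (fun n ↦ norm_rectTerm_le n (by linarith) hs1)
  refine (hsum.hasSum_iff_tendsto_nat).2 ?_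
  simp_rw [sum_rectTerm]
  have hz : HasSum (fun n : ℕ ↦ ((n + 1 : ℝ) : ℂ) ^ (-s)) (riemannZeta s) := by
    have h := (summable_nat_add_iff 1).2 (Complex.summable_one_div_nat_cpow.2 hs)
    rw [zeta_eq_tsum_one_div_nat_add_one_cpow hs]
    convert! h.hasSum using 2 with n
    · push_cast; rw [Complex.cpow_neg, one_div]
    · push_cast; rfl
  have h0 : Tendsto (fun N : ℕ ↦ ((N + 1 : ℝ) : ℂ) ^ (1 - s)) atTop (𝓝 0) := by
    rw [tendsto_zero_iff_norm_tendsto_zero]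
    have : Tendsto (fun N : ℕ ↦ ((N + 1 : ℝ)) ^ (-(s.re - 1))) atTop (𝓝 0) :=
      (tendsto_rpow_neg_atTop (by linarith)).comp
        (tendsto_atTop_add_const_right _ _ tendsto_natCast_atTop_atTop)
    refine this.congr fun N ↦ ?_
    rw [Complex.norm_cpow_eq_rpow_re_of_pos (by positivity)]
    simp
  have := ((hz.tendsto_sum_nat.const_mul (1 - s)).sub h0).add_const 1
  convert! this using 2
  rw [riemannZeta_eq_inv_sub_mul hs1]
  have := sub_ne_zero.2 hs1
  field_simp
  ring

/-- The series `∑ rectTerm n s`, which for `Re s > 1` is computed from the Dirichlet series of `ζ`,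
continues `1 + (1 - s) ζ(s)` to `0 < s < 1` by the identity theorem. -/
lemma hasSum_rectTerm {s : ℝ} (hs : s ∈ Ioo (0 : ℝ) 1) :
    HasSum (fun n ↦ rectTerm n s) (1 - riemannZeta₁ s) := by
  obtain ⟨hs0, hs1⟩ := hs
  -- a bounded convex open set containing `s` and the point `2` of the half-plane `1 < Re z`
  set U : Set ℂ := {z | s / 2 < z.re} ∩ Metric.ball 0 4 with hU
  have hUo : IsOpen U := (isOpen_lt continuous_const Complex.continuous_re).inter Metric.isOpen_ball
  have hUc : Convex ℝ U := (convex_halfSpace_re_gt _).inter (convex_ball _ _)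
  have hsU : (s : ℂ) ∈ U := by
    refine ⟨by simp; linarith, ?_⟩
    simp [abs_of_pos hs0]; linarith
  have h2U : (2 : ℂ) ∈ U := by
    refine ⟨by simp; linarith, ?_⟩
    norm_num
  have hsu : Summable fun n : ℕ ↦ 5 * 4 * (n + 1 : ℝ) ^ (-(s / 2) - 1) :=
    (summable_rpow_succ (by linarith : 0 < s / 2)).mul_left _
  have hle : ∀ (n : ℕ) (z : ℂ), z ∈ U → ‖rectTerm n z‖ ≤ 5 * 4 * (n + 1 : ℝ) ^ (-(s / 2) - 1) := by
    intro n z hz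
    have hz4 : ‖z‖ < 4 := by simpa using hz.2
    have hzre : s / 2 < z.re := hz.1
    rcases eq_or_ne z 1 with rfl | hz1
    · have : rectTerm n 1 = 0 := by simp [rectTerm]
      rw [this, norm_zero]
      positivity
    · refine (norm_rectTerm_le n (by linarith) hz1).trans ?_
      have : ‖1 - z‖ ≤ 5 := (norm_sub_le _ _).trans (by simp; linarith)
      gcongr
      linarith [(Nat.cast_nonneg n : (0 : ℝ) ≤ n)]
  have hd := Complex.differentiableOn_tsum_of_summable_norm hsu
    (fun n ↦ (differentiable_rectTerm n).differentiableOn) hUo hle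
  have heq : EqOn (fun z ↦ ∑' n, rectTerm n z) (fun z ↦ 1 - riemannZeta₁ z) U := by
    refine (hd.analyticOnNhd hUo).eqOn_of_preconnected_of_eventuallyEq
      ((((differentiable_const 1).sub differentiable_riemannZeta₁).differentiableOn).analyticOnNhd
        hUo) hUc.isPreconnected h2U ?_
    have : {z : ℂ | 1 < z.re} ∈ 𝓝 (2 : ℂ) :=
      (isOpen_lt continuous_const Complex.continuous_re).mem_nhds (by simp)
    filter_upwards [this] with z hz using (hasSum_rectTerm_of_one_lt hz).tsum_eq
  have hsum : Summable fun n ↦ rectTerm n (s : ℂ) := .of_norm_bounded hsu fun n ↦ hle n s hsU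
  have h := heq hsU
  beta_reduce at h
  rw [← h]
  exact hsum.hasSum

lemma riemannZeta_ofReal (s : ℝ) : riemannZeta (s : ℂ) = (zetaReal s : ℂ) := by
  have h := riemannZeta_conj (s : ℂ)
  rw [Complex.conj_ofReal] at h
  exact (Complex.conj_eq_iff_re.1 h.symm).symm

/-- On the critical strip `ζ(s)` is the limit of its partial sums after removal of the divergent
main term `∫₀ᴺ x ^ (-s) dx`. -/
lemma tendsto_sum_rpow_sub {s : ℝ} (hs : s ∈ Ioo (0 : ℝ) 1) :
    Tendsto (fun N : ℕ ↦ ∑ n ∈ Finset.range N, (n + 1 : ℝ) ^ (-s) - (N + 1 : ℝ) ^ (1 - s) / (1 - s))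
      atTop (𝓝 (zetaReal s)) := by
  have hs1 : (s : ℂ) ≠ 1 := by exact_mod_cast hs.2.ne
  have h1 : 1 - s ≠ 0 := by linarith [hs.2]
  have h := (hasSum_rectTerm hs).tendsto_sum_nat
  simp_rw [sum_rectTerm] at h
  have hz : 1 - riemannZeta₁ s = (((1 - s) * zetaReal s + 1 : ℝ) : ℂ) := by
    push_cast
    rw [← riemannZeta_ofReal, riemannZeta_eq_inv_sub_mul hs1]
    have := sub_ne_zero.2 hs1
    field_simp
    ring
  rw [hz] at h
  have h' : Tendsto (fun N : ℕ ↦ (1 - s) * ∑ n ∈ Finset.range N, (n + 1 : ℝ) ^ (-s)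
      - (N + 1 : ℝ) ^ (1 - s) + 1) atTop (𝓝 ((1 - s) * zetaReal s + 1)) := by
    have := (Complex.continuous_re.tendsto _).comp h
    rw [Complex.ofReal_re] at this
    refine this.congr fun N ↦ ?_
    rw [Function.comp_apply, ← Complex.ofReal_re ((1 - s) * ∑ n ∈ Finset.range N, (n + 1 : ℝ) ^ (-s)
      - (N + 1 : ℝ) ^ (1 - s) + 1)]
    have hc (k : ℕ) (r : ℝ) : (((k + 1 : ℝ) ^ r : ℝ) : ℂ) = ((k + 1 : ℝ) : ℂ) ^ (r : ℂ) :=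
      Complex.ofReal_cpow (by positivity) r
    congr 1
    simp only [Complex.ofReal_add, Complex.ofReal_sub, Complex.ofReal_mul, Complex.ofReal_sum,
      Complex.ofReal_neg, Complex.ofReal_one, hc]
  convert! (h'.sub_const 1).div_const (1 - s) using 2
  · field_simp
    ring
  · field_simp
    ring

/-! ### The digamma function -/

lemma hasDerivAt_Gamma_of_pos {x : ℝ} (hx : 0 < x) :
    HasDerivAt Real.Gamma (deriv Real.Gamma x) x :=
  (Real.differentiableAt_Gamma fun m ↦ by
    have : (0 : ℝ) ≤ m := m.cast_nonneg
    linarith).hasDerivAt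

lemma complex_differentiableAt_Gamma_of_pos {x : ℝ} (hx : 0 < x) :
    DifferentiableAt ℂ Complex.Gamma x :=
  Complex.differentiableAt_Gamma _ fun m h ↦ by
    have h1 : x = -(m : ℝ) := by exact_mod_cast h
    have : (0 : ℝ) ≤ m := m.cast_nonneg
    linarith

lemma digamma_ofReal_eq {x : ℝ} (hx : 0 < x) :
    Complex.digamma (x : ℂ) = ((deriv Real.Gamma x / Real.Gamma x : ℝ) : ℂ) := by
  have h : deriv Complex.Gamma x = ((deriv Real.Gamma x : ℝ) : ℂ) := by
    rw [← ((funext Complex.Gamma_ofReal) ▸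
      (complex_differentiableAt_Gamma_of_pos hx).hasDerivAt.comp_ofReal.deriv :)]
    exact (hasDerivAt_Gamma_of_pos hx).ofReal_comp.deriv
  rw [Complex.digamma_def, logDeriv_apply, h, Complex.Gamma_ofReal]
  push_cast
  rfl

lemma digammaReal_eq {x : ℝ} (hx : 0 < x) :
    digammaReal x = deriv Real.Gamma x / Real.Gamma x := by
  rw [digammaReal, digamma_ofReal_eq hx, Complex.ofReal_re]

lemma digamma_ofReal {x : ℝ} (hx : 0 < x) :
    Complex.digamma (x : ℂ) = (digammaReal x : ℂ) := by
  rw [digammaReal_eq hx, digamma_ofReal_eq hx]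

lemma digammaReal_one : digammaReal 1 = -Real.eulerMascheroniConstant := by
  rw [digammaReal, Complex.ofReal_one, Complex.digamma_one, ← Complex.ofReal_neg, Complex.ofReal_re]

lemma digammaReal_add_one {x : ℝ} (hx : 0 < x) : digammaReal (x + 1) = digammaReal x + 1 / x := by
  have h := Complex.digamma_apply_add_one (x : ℂ) fun m h ↦ by
    have h1 : x = -(m : ℝ) := by exact_mod_cast h
    have : (0 : ℝ) ≤ m := m.cast_nonneg
    linarith
  rw [digamma_ofReal hx, ← Complex.ofReal_one, ← Complex.ofReal_add,
    digamma_ofReal (by linarith)] at h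
  rw [one_div]
  exact_mod_cast h

lemma hasDerivAt_log_Gamma {x : ℝ} (hx : 0 < x) :
    HasDerivAt (Real.log ∘ Real.Gamma) (digammaReal x) x := by
  rw [digammaReal_eq hx]
  exact (hasDerivAt_Gamma_of_pos hx).log (Real.Gamma_pos_of_pos hx).ne'

lemma log_Gamma_add_one {x : ℝ} (hx : 0 < x) :
    Real.log (Real.Gamma (x + 1)) = Real.log (Real.Gamma x) + Real.log x := by
  rw [Real.Gamma_add_one hx.ne', Real.log_mul hx.ne' (Real.Gamma_pos_of_pos hx).ne', add_comm]

/-- Convexity of `log Γ` compares its derivative `ψ` with the slope `log Γ(x + 1) - log Γ(x)`. -/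
lemma digammaReal_le_log {x : ℝ} (hx : 0 < x) : digammaReal x ≤ Real.log x := by
  have h := Real.convexOn_log_Gamma.le_slope_of_hasDerivAt (mem_Ioi.2 hx)
    (mem_Ioi.2 (by linarith : 0 < x + 1)) (by linarith) (hasDerivAt_log_Gamma hx)
  rw [slope_def_field, Function.comp_apply, Function.comp_apply, log_Gamma_add_one hx] at h
  simpa using h

lemma log_le_digammaReal_add_one {x : ℝ} (hx : 0 < x) : Real.log x ≤ digammaReal (x + 1) := by
  have h := Real.convexOn_log_Gamma.slope_le_of_hasDerivAt (mem_Ioi.2 hx)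
    (mem_Ioi.2 (by linarith : 0 < x + 1)) (by linarith) (hasDerivAt_log_Gamma (by linarith))
  rw [slope_def_field, Function.comp_apply, Function.comp_apply, log_Gamma_add_one hx] at h
  simpa using h

lemma tendsto_digammaReal_sub_log {x : ℝ} (hx : 0 < x) :
    Tendsto (fun N : ℕ ↦ digammaReal (x + N) - Real.log N) atTop (𝓝 0) := by
  have hl (c : ℝ) : Tendsto (fun N : ℕ ↦ Real.log (N + c) - Real.log N) atTop (𝓝 0) :=
    (Real.tendsto_log_comp_add_sub_log c).comp tendsto_natCast_atTop_atTop
  refine tendsto_of_tendsto_of_tendsto_of_le_of_le' (hl (x - 1)) (hl x) ?_ ?_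
  · filter_upwards [eventually_ge_atTop 1] with N hN
    have : (1 : ℝ) ≤ N := by exact_mod_cast hN
    have := log_le_digammaReal_add_one (by linarith : 0 < N + (x - 1))
    rw [show N + (x - 1) + 1 = x + N by ring] at this
    linarith
  · filter_upwards with N
    have := digammaReal_le_log (by positivity : 0 < x + (N : ℝ))
    rw [add_comm x] at this ⊢
    linarith

lemma digammaReal_add_nat {x : ℝ} (hx : 0 < x) (N : ℕ) :
    digammaReal (x + N) = digammaReal x + ∑ n ∈ Finset.range N, 1 / (x + n) := by
  induction N with
  | zero => simp
  | succ N ih =>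
    rw [Finset.sum_range_succ, Nat.cast_succ, ← add_assoc, digammaReal_add_one (by positivity), ih]
    ring

lemma tendsto_sum_one_div_sub_log {x : ℝ} (hx : 0 < x) :
    Tendsto (fun N : ℕ ↦ ∑ n ∈ Finset.range N, 1 / (x + n) - Real.log (N + 1)) atTop
      (𝓝 (-digammaReal x)) := by
  have h1 := tendsto_digammaReal_sub_log hx
  have h2 : Tendsto (fun N : ℕ ↦ Real.log (N + 1) - Real.log N) atTop (𝓝 0) :=
    (Real.tendsto_log_comp_add_sub_log 1).comp tendsto_natCast_atTop_atTop
  have := (h1.sub h2).sub_const (digammaReal x)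
  rw [sub_zero, zero_sub] at this
  refine this.congr fun N ↦ ?_
  rw [digammaReal_add_nat hx]
  ring

/-- Logarithmic derivative of the reflection formula `Γ(s) Γ(1 - s) = π / sin(π s)`. -/
lemma digammaReal_one_sub_sub {s : ℝ} (hs : s ∈ Ioo (0 : ℝ) 1) :
    digammaReal (1 - s) - digammaReal s = Real.pi * Real.cot (Real.pi * s) := by
  obtain ⟨hs0, hs1⟩ := hs
  have hs1' : 0 < 1 - s := by linarith
  have hsin : 0 < Real.sin (Real.pi * s) :=
    Real.sin_pos_of_pos_of_lt_pi (by positivity) (by nlinarith [Real.pi_pos])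
  have hL := (hasDerivAt_Gamma_of_pos hs0).mul
    ((hasDerivAt_Gamma_of_pos hs1').comp s ((hasDerivAt_id s).const_sub 1))
  have hR := (hasDerivAt_const s Real.pi).div
    (((hasDerivAt_id s).const_mul Real.pi).sin) hsin.ne'
  have hfun : Real.Gamma * (Real.Gamma ∘ HSub.hSub 1) =
      (fun _ ↦ Real.pi) / fun x ↦ Real.sin (Real.pi * id x) := by
    ext x
    exact Real.Gamma_mul_Gamma_one_sub x
  rw [hfun] at hL
  have hd := hL.unique hR
  have hp := Real.Gamma_mul_Gamma_one_sub s
  simp only [id, Function.comp_apply] at hd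
  have hG := Real.Gamma_pos_of_pos hs0
  have hG' := Real.Gamma_pos_of_pos hs1'
  rw [digammaReal_eq hs0, digammaReal_eq hs1', Real.cot_eq_cos_div_sin,
    div_sub_div _ _ hG'.ne' hG.ne', mul_comm (Real.Gamma (1 - s)) (Real.Gamma s), hp,
    div_eq_iff (by positivity)]
  have : deriv Real.Gamma (1 - s) * Real.Gamma s - Real.Gamma (1 - s) * deriv Real.Gamma s =
    Real.pi * (Real.cos (Real.pi * s) * Real.pi) / Real.sin (Real.pi * s) ^ 2 := by
    linear_combination -hd
  rw [this]
  field_simp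

/-! ### Trapezoidal and midpoint errors -/

lemma le_of_hasDerivAt_nonneg {f f' : ℝ → ℝ} {a b : ℝ} (hab : a ≤ b)
    (hf : ∀ x ∈ Icc a b, HasDerivAt f (f' x) x) (hf' : ∀ x ∈ Icc a b, 0 ≤ f' x) : f a ≤ f b := by
  refine monotoneOn_of_deriv_nonneg (convex_Icc a b)
    (fun x hx ↦ (hf x hx).continuousAt.continuousWithinAt)
    (fun x hx ↦ (hf x (interior_subset hx)).differentiableAt.differentiableWithinAt)
    (fun x hx ↦ ?_) (left_mem_Icc.2 hab) (right_mem_Icc.2 hab) hab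
  rw [(hf x (interior_subset hx)).deriv]
  exact hf' x (interior_subset hx)

/-- The signed error, trapezoid minus integral, of the trapezoidal rule for `x ↦ x ^ (-s)` on
`[a, a + 1]`. -/
noncomputable def trapError (s a : ℝ) : ℝ :=
  (a ^ (-s) + (a + 1) ^ (-s)) / 2 - ((a + 1) ^ (1 - s) - a ^ (1 - s)) / (1 - s)

/-- The limiting case `s → 1` of `trapError`, in which the integral is a logarithm. At `s = 1` itself
`trapError` divides by zero. -/
noncomputable def trapErrorInv (a : ℝ) : ℝ :=
  (1 / a + 1 / (a + 1)) / 2 - (Real.log (a + 1) - Real.log a)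

/-- The first two correction terms, `-f' / 12 + f''' / 720`, of the Euler–Maclaurin formula
for `f = x ^ (-s)`. -/
noncomputable def eulerMaclaurinTerm (s x : ℝ) : ℝ :=
  s / 12 * x ^ (-s - 1) - s * (s + 1) * (s + 2) / 720 * x ^ (-s - 3)

lemma hasDerivAt_const_mul_rpow (c r : ℝ) {x : ℝ} (hx : 0 < x) :
    HasDerivAt (fun y : ℝ ↦ c * y ^ r) (c * r * x ^ (r - 1)) x := by
  have := (Real.hasDerivAt_rpow_const (p := r) (Or.inl hx.ne')).const_mul c
  rwa [← mul_assoc] at this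

lemma hasDerivAt_sub_pow (a x : ℝ) (k : ℕ) :
    HasDerivAt (fun y : ℝ ↦ (y - a) ^ k) (k * (x - a) ^ (k - 1)) x := by
  exact (((hasDerivAt_id x).sub_const a).pow k).congr_deriv (by simp)

/-- Euler–Maclaurin summation over one step with the sign of its remainder: since the Bernoulli
polynomial satisfies `B₆(t) - B₆(0) = -t²(1-t)²(1/2+t-t²) ≤ 0` on `[0, 1]` and the sixth derivative
of `x ^ (-s)` is positive, the remainder is nonnegative. -/
lemma eulerMaclaurinTerm_sub_le_trapError {s a : ℝ} (hs : s ∈ Ioo (0 : ℝ) 1) (ha : 0 < a) :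
    eulerMaclaurinTerm s a - eulerMaclaurinTerm s (a + 1) ≤ trapError s a := by
  obtain ⟨hs0, hs1⟩ := hs
  have h1s : 1 - s ≠ 0 := by linarith
  -- the successive derivatives of `-(B₆(y - a) - B₆(0))`
  let p0 : ℝ → ℝ := fun y ↦ 1 / 2 * (y - a) ^ 2 - 5 / 2 * (y - a) ^ 4 + 3 * (y - a) ^ 5 - (y - a) ^ 6
  let p1 : ℝ → ℝ := fun y ↦ (y - a) ^ 1 - 10 * (y - a) ^ 3 + 15 * (y - a) ^ 4 - 6 * (y - a) ^ 5
  let p2 : ℝ → ℝ := fun y ↦ (y - a) ^ 0 - 30 * (y - a) ^ 2 + 60 * (y - a) ^ 3 - 30 * (y - a) ^ 4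
  let p3 : ℝ → ℝ := fun y ↦ -60 * (y - a) ^ 1 + 180 * (y - a) ^ 2 - 120 * (y - a) ^ 3
  let p4 : ℝ → ℝ := fun y ↦ -60 * (y - a) ^ 0 + 360 * (y - a) ^ 1 - 360 * (y - a) ^ 2
  let p5 : ℝ → ℝ := fun y ↦ 360 * (y - a) ^ 0 - 720 * (y - a) ^ 1
  have hp (x : ℝ) (k : ℕ) := hasDerivAt_sub_pow a x k
  have hp0 (x : ℝ) : HasDerivAt p0 (p1 x) x :=
    (((((hp x 2).const_mul _).sub ((hp x 4).const_mul _)).add ((hp x 5).const_mul _)).sub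
      (hp x 6)).congr_deriv (by simp only [p1]; norm_num; ring)
  have hp1 (x : ℝ) : HasDerivAt p1 (p2 x) x :=
    ((((hp x 1).sub ((hp x 3).const_mul _)).add ((hp x 4).const_mul _)).sub
      ((hp x 5).const_mul _)).congr_deriv (by simp only [p2]; norm_num; ring)
  have hp2 (x : ℝ) : HasDerivAt p2 (p3 x) x :=
    ((((hp x 0).sub ((hp x 2).const_mul _)).add ((hp x 3).const_mul _)).sub
      ((hp x 4).const_mul _)).congr_deriv (by simp only [p3]; norm_num; ring)
  have hp3 (x : ℝ) : HasDerivAt p3 (p4 x) x :=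
    ((((hp x 1).const_mul _).add ((hp x 2).const_mul _)).sub
      ((hp x 3).const_mul _)).congr_deriv (by simp only [p4]; norm_num; ring)
  have hp4 (x : ℝ) : HasDerivAt p4 (p5 x) x :=
    ((((hp x 0).const_mul _).add ((hp x 1).const_mul _)).sub
      ((hp x 2).const_mul _)).congr_deriv (by simp only [p5]; norm_num; ring)
  have hp5 (x : ℝ) : HasDerivAt p5 (-720) x :=
    (((hp x 0).const_mul _).sub ((hp x 1).const_mul _)).congr_deriv (by norm_num)
  -- the antiderivative, obtained by repeated integration by parts, of the remainder's integrand
  have key := le_of_hasDerivAt_nonneg (a := a) (b := a + 1)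
    (f := fun y ↦ p0 y * (-s * (-s - 1) * (-s - 1 - 1) * (-s - 1 - 1 - 1) * (-s - 1 - 1 - 1 - 1)
          * y ^ (-s - 1 - 1 - 1 - 1 - 1))
        - p1 y * (-s * (-s - 1) * (-s - 1 - 1) * (-s - 1 - 1 - 1) * y ^ (-s - 1 - 1 - 1 - 1))
        + p2 y * (-s * (-s - 1) * (-s - 1 - 1) * y ^ (-s - 1 - 1 - 1))
        - p3 y * (-s * (-s - 1) * y ^ (-s - 1 - 1)) + p4 y * (-s * y ^ (-s - 1))
        - p5 y * (1 * y ^ (-s)) - 720 / (1 - s) * y ^ (1 - s))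
    (f' := fun y ↦ p0 y * (-s * (-s - 1) * (-s - 1 - 1) * (-s - 1 - 1 - 1) * (-s - 1 - 1 - 1 - 1)
          * (-s - 1 - 1 - 1 - 1 - 1) * y ^ (-s - 1 - 1 - 1 - 1 - 1 - 1)))
    (by linarith) (fun y hy ↦ ?_) (fun y hy ↦ ?_)
  · simp only [p0, p1, p2, p3, p4, p5] at key
    norm_num at key
    rw [show -s - 1 - 1 - 1 = -s - 3 by ring] at key
    rw [eulerMaclaurinTerm, eulerMaclaurinTerm, trapError]
    have e (u : ℝ) : 720 / (1 - s) * u = 720 * (u / (1 - s)) := by ring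
    rw [e, e] at key
    rw [sub_div]
    linarith
  · have hy0 : 0 < y := ha.trans_le hy.1
    have hq (c r : ℝ) := hasDerivAt_const_mul_rpow c r hy0
    refine (((((((hp0 y).mul (hq _ _)).sub ((hp1 y).mul (hq _ _))).add
      ((hp2 y).mul (hq _ _))).sub ((hp3 y).mul (hq _ _))).add ((hp4 y).mul (hq _ _))).sub
      ((hp5 y).mul (hq _ _))).sub (hq _ _) |>.congr_deriv ?_
    rw [show 720 / (1 - s) * (1 - s) = 720 by field_simp, show 1 - s - 1 = -s by ring]
    ring
  · have hy0 : 0 < y := ha.trans_le hy.1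
    have h0 : 0 ≤ y - a := by linarith [hy.1]
    have h1 : 0 ≤ 1 - (y - a) := by linarith [hy.2]
    have e1 : p0 y = (y - a) ^ 2 * (1 - (y - a)) ^ 2 * (1 / 2 + (y - a) * (1 - (y - a))) := by
      simp only [p0]; ring
    have e2 : -s * (-s - 1) * (-s - 1 - 1) * (-s - 1 - 1 - 1) * (-s - 1 - 1 - 1 - 1)
          * (-s - 1 - 1 - 1 - 1 - 1) = s * (s + 1) * (s + 2) * (s + 3) * (s + 4) * (s + 5) := by ring
    rw [e1, e2]
    positivity

/-- The trapezoidal error is close to linear in `s`: it exceeds the chord between its values at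
`s = 0` and `s = 1` by at most a telescoping multiple of `s (1 - s)`. Both sides are integrals
against `t (1 - t) / 2`, and the integrands are compared through Bernoulli's inequality
for `x ^ (1 - s)`. -/
lemma trapError_le {s a : ℝ} (hs : s ∈ Ioo (0 : ℝ) 1) (ha : 1 ≤ a) :
    trapError s a ≤ s * trapErrorInv a + s * (1 - s) / 4 * (1 / a - 1 / (a + 1)) := by
  obtain ⟨hs0, hs1⟩ := hs
  have h1s : 1 - s ≠ 0 := by linarith
  -- the weight `t (1 - t) / 2` at `t = y - a`, and its derivative
  let w0 : ℝ → ℝ := fun y ↦ 1 / 2 * (y - a) ^ 1 - 1 / 2 * (y - a) ^ 2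
  let w1 : ℝ → ℝ := fun y ↦ 1 / 2 * (y - a) ^ 0 - (y - a) ^ 1
  have hp (x : ℝ) (k : ℕ) := hasDerivAt_sub_pow a x k
  have hw0 (x : ℝ) : HasDerivAt w0 (w1 x) x :=
    (((hp x 1).const_mul _).sub ((hp x 2).const_mul _)).congr_deriv
      (by simp only [w1]; norm_num; ring)
  have hw1 (x : ℝ) : HasDerivAt w1 (-1) x :=
    (((hp x 0).const_mul _).sub (hp x 1)).congr_deriv (by norm_num)
  -- integration by parts twice turns the weighted integrals of second derivatives into
  -- trapezoidal errors
  have key := le_of_hasDerivAt_nonneg (a := a) (b := a + 1)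
    (f := fun y ↦ s * (w0 y * (-1 * y ^ (-1 - 1 : ℝ)) - w1 y * (1 * y ^ (-1 : ℝ)) - Real.log y)
      - (w0 y * (-s * y ^ (-s - 1)) - w1 y * (1 * y ^ (-s)) - 1 / (1 - s) * y ^ (1 - s))
      + (-(s * (1 - s) / 4)) * y ^ (-1 : ℝ))
    (f' := fun y ↦ s * (w0 y * (2 * y ^ (-1 - 1 - 1 : ℝ)))
      - w0 y * (s * (s + 1) * y ^ (-s - 1 - 1)) + s * (1 - s) / 4 * y ^ (-1 - 1 : ℝ))
    (by linarith) (fun y hy ↦ ?_) (fun y hy ↦ ?_)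
  · simp only [w0, w1] at key
    norm_num at key
    rw [Real.rpow_neg_one, Real.rpow_neg_one] at key
    rw [trapError, trapErrorInv, one_div, one_div, sub_div]
    have e (u : ℝ) : (1 - s)⁻¹ * u = u / (1 - s) := by ring
    rw [e, e] at key
    linarith
  · have hy0 : 0 < y := by linarith [hy.1]
    have hq (c r : ℝ) := hasDerivAt_const_mul_rpow c r hy0
    refine (((((hw0 y).mul (hq _ _)).sub ((hw1 y).mul (hq _ _))).sub
      (Real.hasDerivAt_log hy0.ne')).const_mul s).sub ((((hw0 y).mul (hq _ _)).sub
        ((hw1 y).mul (hq _ _))).sub (hq _ _)) |>.add (hq _ _) |>.congr_deriv ?_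
    rw [show 1 / (1 - s) * (1 - s) = 1 by field_simp, show 1 - s - 1 = -s by ring,
      Real.rpow_neg_one]
    ring
  · have hy1 : 1 ≤ y := by linarith [hy.1]
    have hy0 : 0 < y := by linarith
    have h0 : 0 ≤ y - a := by linarith [hy.1]
    have h1 : 0 ≤ 1 - (y - a) := by linarith [hy.2]
    have hw : w0 y = (y - a) * (1 - (y - a)) / 2 := by simp only [w0]; ring
    have hw0' : 0 ≤ w0 y := by rw [hw]; positivity
    have hw8 : w0 y ≤ 1 / 8 := by rw [hw]; nlinarith [sq_nonneg (y - a - 1 / 2)]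
    -- Bernoulli: `y ^ (1 - s) ≤ s + (1 - s) y`
    have hB : y ^ (1 - s) ≤ 1 + (1 - s) * (y - 1) := by
      have := _root_.rpow_one_add_le_one_add_mul_self (by linarith : -1 ≤ y - 1)
        (by linarith : 0 ≤ 1 - s) (by linarith)
      simpa using this
    have e1 : y ^ (-s - 1 - 1) = y ^ (1 - s) * (y ^ 3)⁻¹ := by
      rw [show -s - 1 - 1 = (1 - s) + (-3 : ℝ) by ring, Real.rpow_add hy0, Real.rpow_neg hy0.le]
      norm_cast
    have e2 : y ^ (-1 - 1 - 1 : ℝ) = (y ^ 3)⁻¹ := by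
      rw [show (-1 - 1 - 1 : ℝ) = -3 by norm_num, Real.rpow_neg hy0.le]
      norm_cast
    have e3 : y ^ (-1 - 1 : ℝ) = y * (y ^ 3)⁻¹ := by
      rw [show (-1 - 1 : ℝ) = 1 + -3 by norm_num, Real.rpow_add hy0, Real.rpow_neg hy0.le,
        Real.rpow_one]
      norm_cast
    rw [e1, e2, e3]
    have hX : (s + 1) * y ^ (1 - s) - 2 ≤ 2 * (1 - s) * y := by
      have h2 := mul_le_mul_of_nonneg_left hB (by linarith : 0 ≤ s + 1)
      have h3 : 0 ≤ (1 - s) * ((1 - s) * y + s + 2) :=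
        mul_nonneg (by linarith) (by nlinarith)
      linarith
    have hwX : w0 y * ((s + 1) * y ^ (1 - s) - 2) ≤ 1 / 8 * (2 * (1 - s) * y) := by
      have : 0 ≤ 2 * (1 - s) * y := by nlinarith
      exact (mul_le_mul_of_nonneg_left hX hw0').trans (mul_le_mul_of_nonneg_right hw8 this)
    have : 0 ≤ s * (y ^ 3)⁻¹ * (1 / 8 * (2 * (1 - s) * y) - w0 y * ((s + 1) * y ^ (1 - s) - 2)) :=
      mul_nonneg (by positivity) (by linarith)
    linarith

/-- The midpoint rule for `∫ dx / x` on `[a, a + 1]`, with a telescoping error bound. -/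
lemma log_add_one_sub_log_le {a : ℝ} (ha : 0 < a) :
    Real.log (a + 1) - Real.log a ≤ 1 / (a + 1 / 2) + 1 / 24 * (1 / a ^ 2 - 1 / (a + 1) ^ 2) := by
  -- with `u = 1 / (2 a + 1)` the left side is `log (1 + u) - log (1 - u)`
  set u : ℝ := 1 / (2 * a + 1) with hu
  have hu0 : 0 ≤ u := by positivity
  have hu1 : u < 1 := by rw [hu, div_lt_one (by positivity)]; linarith
  have key := le_of_hasDerivAt_nonneg (a := 0) (b := u)
    (f := fun x ↦ 2 * x + 2 / 3 * x ^ 3 * (1 - x ^ 2)⁻¹ - (Real.log (1 + x) - Real.log (1 - x)))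
    (f' := fun x ↦ 4 / 3 * x ^ 4 * ((1 - x ^ 2) ^ 2)⁻¹)
    hu0 (fun x hx ↦ ?_) (fun x hx ↦ by positivity)
  · norm_num at key
    have e1 : Real.log (1 + u) = Real.log (a + 1) - Real.log (a + 1 / 2) := by
      rw [← Real.log_div (by positivity) (by positivity)]
      congr 1
      rw [hu]; field_simp; ring
    have e2 : Real.log (1 - u) = Real.log a - Real.log (a + 1 / 2) := by
      rw [← Real.log_div (by positivity) (by positivity)]
      congr 1
      rw [hu]; field_simp; ring
    have e3 : 2 * u = 1 / (a + 1 / 2) := by rw [hu]; field_simp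
    have e4 : u ^ 3 * (1 - u ^ 2)⁻¹ ≤ 1 / 16 * (1 / a ^ 2 - 1 / (a + 1) ^ 2) := by
      have e5 : u ^ 3 * (1 - u ^ 2)⁻¹ = 1 / (4 * a * (a + 1) * (2 * a + 1)) := by
        have : 1 - u ^ 2 = 4 * a * (a + 1) / (2 * a + 1) ^ 2 := by rw [hu]; field_simp; ring
        rw [this, hu]; field_simp
      have e6 : 1 / 16 * (1 / a ^ 2 - 1 / (a + 1) ^ 2) = (2 * a + 1) / (16 * a ^ 2 * (a + 1) ^ 2) := by
        field_simp; ring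
      rw [e5, e6, div_le_div_iff₀ (by positivity) (by positivity)]
      have : 0 ≤ 4 * a * (a + 1) := by positivity
      nlinarith
    rw [e1, e2] at key
    linarith
  · have hx1 : 0 < 1 - x := by linarith [hx.2]
    have hx2 : 0 < 1 + x := by linarith [hx.1]
    have hx3 : 1 - x ^ 2 ≠ 0 := by nlinarith
    have hi : HasDerivAt (fun x : ℝ ↦ (1 - x ^ 2)⁻¹) (2 * x / (1 - x ^ 2) ^ 2) x := by
      have := ((hasDerivAt_pow 2 x).const_sub 1).inv hx3
      exact this.congr_deriv (by norm_num)
    refine ((((hasDerivAt_id x).const_mul 2).add (((hasDerivAt_pow 3 x).const_mul (2 / 3)).mul hi)).sub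
      ((((hasDerivAt_id x).const_add 1).log hx2.ne').sub
        (((hasDerivAt_id x).const_sub 1).log hx1.ne'))).congr_deriv ?_
    have : 1 - x ^ 2 = (1 - x) * (1 + x) := by ring
    simp only [id]
    rw [this]
    field_simp
    norm_num
    ring

/-! ### Upper bound -/

lemma tendsto_one_div_natCast_add_one : Tendsto (fun N : ℕ ↦ 1 / (N + 1 : ℝ)) atTop (𝓝 0) :=
  tendsto_one_div_add_atTop_nhds_zero_nat

lemma tendsto_rpow_natCast_add_one {r : ℝ} (hr : r < 0) :
    Tendsto (fun N : ℕ ↦ (N + 1 : ℝ) ^ r) atTop (𝓝 0) := by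
  have := (tendsto_rpow_neg_atTop (neg_pos.2 hr)).comp
    (tendsto_atTop_add_const_right _ (1 : ℝ) tendsto_natCast_atTop_atTop)
  simpa [Function.comp_def] using this

lemma sum_trapError (s : ℝ) (N : ℕ) :
    ∑ n ∈ Finset.range N, trapError s (n + 1) =
      ∑ n ∈ Finset.range N, (n + 1 : ℝ) ^ (-s) - (N + 1 : ℝ) ^ (1 - s) / (1 - s)
        + 1 / 2 * (N + 1 : ℝ) ^ (-s) + (1 / (1 - s) - 1 / 2) := by
  induction N with
  | zero => simp
  | succ N ih =>
    rw [Finset.sum_range_succ, Finset.sum_range_succ, ih, trapError]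
    push_cast
    ring

lemma tendsto_sum_trapError {s : ℝ} (hs : s ∈ Ioo (0 : ℝ) 1) :
    Tendsto (fun N : ℕ ↦ ∑ n ∈ Finset.range N, trapError s (n + 1)) atTop
      (𝓝 (zetaReal s + (1 / (1 - s) - 1 / 2))) := by
  simp_rw [sum_trapError]
  have h := (tendsto_rpow_natCast_add_one (neg_neg_of_pos hs.1)).const_mul (1 / 2)
  simpa using ((tendsto_sum_rpow_sub hs).add h).add_const (1 / (1 - s) - 1 / 2)

lemma sum_trapErrorInv (N : ℕ) :
    ∑ n ∈ Finset.range N, trapErrorInv (n + 1) =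
      (harmonic N - Real.log (N + 1)) - 1 / 2 + 1 / 2 * (1 / (N + 1)) := by
  induction N with
  | zero => simp
  | succ N ih =>
    rw [Finset.sum_range_succ, ih, trapErrorInv, harmonic_succ]
    push_cast
    ring

lemma zetaReal_le {s : ℝ} (hs : s ∈ Ioo (0 : ℝ) 1) :
    zetaReal s + 1 / (1 - s) ≤
      1 / 2 + s * (Real.eulerMascheroniConstant - 1 / 2) + s * (1 - s) / 4 := by
  have h1 : Tendsto (fun N : ℕ ↦ s * ∑ n ∈ Finset.range N, trapErrorInv (n + 1) + s * (1 - s) / 4)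
      atTop (𝓝 (s * (Real.eulerMascheroniConstant - 1 / 2) + s * (1 - s) / 4)) := by
    simp_rw [sum_trapErrorInv]
    simpa using (((Real.tendsto_harmonic_sub_log_add_one.sub_const (1 / 2)).add
      (tendsto_one_div_natCast_add_one.const_mul (2⁻¹ : ℝ))).const_mul s).add_const (s * (1 - s) / 4)
  have hss : 0 ≤ s * (1 - s) / 4 := by nlinarith [hs.1, hs.2]
  have hfin (N : ℕ) : ∑ n ∈ Finset.range N, trapError s (n + 1) ≤
      s * ∑ n ∈ Finset.range N, trapErrorInv (n + 1) + s * (1 - s) / 4 * (1 - 1 / (N + 1)) := by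
    induction N with
    | zero => simp
    | succ N ih =>
      have := trapError_le hs (by linarith [(Nat.cast_nonneg N : (0 : ℝ) ≤ N)] : (1 : ℝ) ≤ N + 1)
      rw [Finset.sum_range_succ, Finset.sum_range_succ]
      push_cast
      linarith
  have := le_of_tendsto_of_tendsto' (tendsto_sum_trapError hs) h1 fun N ↦ (hfin N).trans <| by
    have := mul_nonneg hss (by positivity : (0 : ℝ) ≤ 1 / (N + 1))
    linarith
  linarith

lemma neg_digammaReal_two_sub_le {s : ℝ} (hs : s ∈ Ioo (0 : ℝ) 1) :
    -digammaReal (2 - s) ≤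
      Real.eulerMascheroniConstant - (1 - s) - s * (1 - s) * (1 / 4 + 1 / 18) := by
  obtain ⟨hs0, hs1⟩ := hs
  have hss : 0 < s * (1 - s) := mul_pos hs0 (by linarith)
  -- the exact gap below the chord of `1 / x` on `[a, a + 1]`
  have hterm (a : ℝ) (ha : 0 < a) : 1 / (a + 1 - s) =
      (1 - s) / (a + 1) + s / a - s * (1 - s) * (1 / (a * (a + 1) * (a + 1 - s))) := by
    have : a + 1 - s ≠ 0 := by linarith
    field_simp
    ring
  have hfin (N : ℕ) (hN : 2 ≤ N) : ∑ n ∈ Finset.range N, 1 / (2 - s + n) ≤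
      harmonic N - (1 - s) * (1 - 1 / (N + 1)) - s * (1 - s) * (1 / 4 + 1 / 18) := by
    induction N, hN using Nat.le_induction with
    | base =>
      have h1 := hterm 1 one_pos
      have h2 := hterm 2 two_pos
      have h3 : 1 / 4 ≤ 1 / ((1 : ℝ) * (1 + 1) * (1 + 1 - s)) :=
        one_div_le_one_div_of_le (by nlinarith) (by linarith)
      have h4 : 1 / 18 ≤ 1 / ((2 : ℝ) * (2 + 1) * (2 + 1 - s)) :=
        one_div_le_one_div_of_le (by nlinarith) (by linarith)
      have h5 := mul_le_mul_of_nonneg_left h3 hss.le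
      have h6 := mul_le_mul_of_nonneg_left h4 hss.le
      rw [Finset.sum_range_succ, Finset.sum_range_one, show (harmonic 2 : ℚ) = 3 / 2 by
        norm_num [harmonic, Finset.sum_range_succ]]
      push_cast
      rw [show 2 - s + 0 = 1 + 1 - s by ring, show 2 - s + 1 = 2 + 1 - s by ring, h1, h2]
      linarith
    | succ N hN ih =>
      have h := hterm (N + 1) (by positivity)
      have h0 : 0 ≤ s * (1 - s) * (1 / ((N + 1 : ℝ) * (N + 1 + 1) * (N + 1 + 1 - s))) := by
        have : 0 < (N : ℝ) + 1 + 1 - s := by linarith [(Nat.cast_nonneg N : (0 : ℝ) ≤ N)]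
        positivity
      rw [Finset.sum_range_succ, harmonic_succ, show 2 - s + (N : ℝ) = N + 1 + 1 - s by ring, h]
      push_cast
      have e1 : (1 - s) / ((N : ℝ) + 1 + 1) = (1 - s) * (1 / (N + 1 + 1)) := by ring
      have e2 : s / ((N : ℝ) + 1) = (N + 1 : ℝ)⁻¹ - (1 - s) * (1 / (N + 1)) := by ring
      rw [e1, e2]
      linarith
  have hlim : Tendsto (fun N : ℕ ↦ (harmonic N - Real.log (N + 1)) - (1 - s) * (1 - 1 / (N + 1 : ℝ))
      - s * (1 - s) * (1 / 4 + 1 / 18)) atTop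
      (𝓝 (Real.eulerMascheroniConstant - (1 - s) - s * (1 - s) * (1 / 4 + 1 / 18))) := by
    simpa using (Real.tendsto_harmonic_sub_log_add_one.sub
      ((tendsto_one_div_natCast_add_one.const_sub 1).const_mul (1 - s))).sub_const
        (s * (1 - s) * (1 / 4 + 1 / 18))
  refine le_of_tendsto_of_tendsto (tendsto_sum_one_div_sub_log (by linarith : 0 < 2 - s)) hlim ?_
  filter_upwards [eventually_ge_atTop 2] with N hN
  linarith [hfin N hN]

lemma F_eq {s : ℝ} (hs : s ∈ Ioo (0 : ℝ) 1) :
    F s = zetaReal s + 1 / (1 - s) - digammaReal (2 - s) := by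
  have := digammaReal_add_one (by linarith [hs.2] : 0 < 1 - s)
  rw [show 1 - s + 1 = 2 - s by ring] at this
  rw [F, this]
  ring

lemma F_lt {s : ℝ} (hs : s ∈ Ioo (0 : ℝ) 1) : F s < slope * s + intercept := by
  have h1 := zetaReal_le hs
  have h2 := neg_digammaReal_two_sub_le hs
  have hss : 0 < s * (1 - s) := mul_pos hs.1 (by linarith [hs.2])
  rw [F_eq hs, slope, intercept]
  linarith

/-! ### Lower bound -/

lemma le_zetaReal {s : ℝ} (hs : s ∈ Ioo (0 : ℝ) 1) :
    1 / 2 + s / 12 - s * (s + 1) * (s + 2) / 720 ≤ zetaReal s + 1 / (1 - s) := by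
  have h1 : Tendsto (fun N : ℕ ↦ eulerMaclaurinTerm s 1 - eulerMaclaurinTerm s (N + 1)) atTop
      (𝓝 (s / 12 - s * (s + 1) * (s + 2) / 720)) := by
    have h := ((tendsto_rpow_natCast_add_one (by linarith [hs.1] : -s - 1 < 0)).const_mul
      (s / 12)).sub ((tendsto_rpow_natCast_add_one (by linarith [hs.1] : -s - 3 < 0)).const_mul
      (s * (s + 1) * (s + 2) / 720))
    simpa [eulerMaclaurinTerm] using h.const_sub (eulerMaclaurinTerm s 1)
  have hfin (N : ℕ) : eulerMaclaurinTerm s 1 - eulerMaclaurinTerm s (N + 1) ≤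
      ∑ n ∈ Finset.range N, trapError s (n + 1) := by
    induction N with
    | zero => simp
    | succ N ih =>
      have := eulerMaclaurinTerm_sub_le_trapError hs (by positivity : (0 : ℝ) < N + 1)
      rw [Finset.sum_range_succ]
      push_cast
      linarith
  linarith [le_of_tendsto_of_tendsto' h1 (tendsto_sum_trapError hs) hfin]

lemma sum_one_div_sq_le (N : ℕ) (hN : 2 ≤ N) :
    ∑ n ∈ Finset.range N, 1 / (n + 3 / 2 : ℝ) ^ 2 ≤ 0.938 - 1 / (N + 1 : ℝ) := by
  induction N, hN using Nat.le_induction with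
  | base => norm_num [Finset.sum_range_succ]
  | succ N hN ih =>
    have : 1 / (N + 3 / 2 : ℝ) ^ 2 ≤ 1 / (N + 1) - 1 / (N + 1 + 1) := by
      rw [div_sub_div _ _ (by positivity) (by positivity),
        div_le_div_iff₀ (by positivity) (by positivity)]
      nlinarith
    rw [Finset.sum_range_succ]
    push_cast
    linarith

lemma le_sum_one_div_sq (N : ℕ) (hN : 3 ≤ N) :
    0.908 - 1 / (N + 3 / 2 : ℝ) ≤ ∑ n ∈ Finset.range N, 1 / (n + 3 / 2 : ℝ) ^ 2 := by
  induction N, hN using Nat.le_induction with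
  | base => norm_num [Finset.sum_range_succ]
  | succ N hN ih =>
    have : 1 / (N + 3 / 2 : ℝ) - 1 / (N + 1 + 3 / 2) ≤ 1 / (N + 3 / 2 : ℝ) ^ 2 := by
      rw [div_sub_div _ _ (by positivity) (by positivity),
        div_le_div_iff₀ (by positivity) (by positivity)]
      nlinarith [(Nat.cast_nonneg N : (0 : ℝ) ≤ N)]
    rw [Finset.sum_range_succ]
    push_cast
    linarith

/-- Quadratic lower bound for `-ψ(2 - s)` around `s = 1 / 2`. The constant bounds `-ψ(3 / 2)` from
below, and `[0.898, 0.938]` encloses `ψ'(3 / 2) = ∑ 1 / (n + 3 / 2) ^ 2`. -/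
lemma le_neg_digammaReal_two_sub {s c : ℝ} (hs : s ∈ Ioo (0 : ℝ) 1)
    (hc : c * (s - 1 / 2) ≤ 0.898 * (s - 1 / 2)) (hc' : c * (s - 1 / 2) ≤ 0.938 * (s - 1 / 2)) :
    2 / 3 - Real.log 2 - 1 / 96 + c * (s - 1 / 2) + 2 / 9 * (s - 1 / 2) ^ 2 ≤
      -digammaReal (2 - s) := by
  obtain ⟨hs0, hs1⟩ := hs
  set t : ℝ := s - 1 / 2 with ht
  have hs : s = t + 1 / 2 := by rw [ht]; ring
  have hfin (N : ℕ) (hN : 1 ≤ N) :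
      2 / 3 - Real.log 2 - 1 / 96 + 1 / 24 * (1 / (N + 1 : ℝ) ^ 2)
        + t * ∑ n ∈ Finset.range N, 1 / (n + 3 / 2 : ℝ) ^ 2 + 2 / 9 * t ^ 2 ≤
      ∑ n ∈ Finset.range N, 1 / (2 - s + n) - Real.log (N + 1) := by
    induction N, hN using Nat.le_induction with
    | base =>
      have h : 2 / 3 + t * (4 / 9) + 2 / 9 * t ^ 2 ≤ 1 / (2 - s) := by
        rw [le_div_iff₀ (by linarith)]
        have : 0 ≤ t ^ 2 * s := by positivity
        rw [hs] at this ⊢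
        linarith
      norm_num
      rw [one_div] at h
      linarith
    | succ N hN ih =>
      have hl := log_add_one_sub_log_le (by positivity : (0 : ℝ) < N + 1)
      have h : 1 / (N + 3 / 2 : ℝ) + t * (1 / (N + 3 / 2 : ℝ) ^ 2) ≤ 1 / (2 - s + N) := by
        have hpos : 0 < 2 - s + (N : ℝ) := by linarith [(Nat.cast_nonneg N : (0 : ℝ) ≤ N)]
        have e : 1 / (N + 3 / 2 : ℝ) + t * (1 / (N + 3 / 2 : ℝ) ^ 2)
            = (N + 3 / 2 + t) / (N + 3 / 2 : ℝ) ^ 2 := by field_simp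
        rw [e, div_le_div_iff₀ (by positivity) hpos]
        rw [hs]
        nlinarith [sq_nonneg t]
      rw [Finset.sum_range_succ, Finset.sum_range_succ]
      push_cast
      rw [show (N : ℝ) + 1 + 1 / 2 = N + 3 / 2 by ring] at hl
      linarith
  refine ge_of_tendsto (tendsto_sum_one_div_sub_log (by linarith : 0 < 2 - s)) ?_
  filter_upwards [eventually_ge_atTop 100] with N hN
  have hN' : (100 : ℝ) ≤ N := by exact_mod_cast hN
  refine le_trans ?_ (hfin N (by omega))
  have hQ1 := sum_one_div_sq_le N (by omega)
  have hQ2 := le_sum_one_div_sq N (by omega)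
  set Q := ∑ n ∈ Finset.range N, 1 / (n + 3 / 2 : ℝ) ^ 2
  have h1 : 1 / (N + 3 / 2 : ℝ) ≤ 0.01 := by
    rw [div_le_iff₀ (by positivity)]; linarith
  have h2 : 0 ≤ 1 / (N + 1 : ℝ) := by positivity
  have h3 : 0 ≤ 1 / 24 * (1 / (N + 1 : ℝ) ^ 2) := by positivity
  have h4 : c * t ≤ t * Q := by
    rcases le_total 0 t with h | h
    · nlinarith
    · nlinarith
  linarith

lemma lt_F {s : ℝ} (hs : s ∈ Ioo (0 : ℝ) 1) : s < F s := by
  have h1 := le_zetaReal hs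
  have hl := Real.log_two_lt_d9
  rw [F_eq hs]
  obtain ⟨t, ht⟩ : ∃ t, s = t + 1 / 2 := ⟨s - 1 / 2, by ring⟩
  have e : s - 1 / 2 = t := by linarith
  have ht0 : -1 / 2 < t := by linarith [hs.1]
  have ht1 : t < 1 / 2 := by linarith [hs.2]
  rcases le_total (1 / 2) s with h | h
  · have h2 := le_neg_digammaReal_two_sub (c := 0.898) hs le_rfl (by nlinarith)
    rw [e] at h2
    rw [ht] at h1 h2 ⊢
    have h3 : t ^ 3 ≤ t ^ 2 / 2 := by nlinarith [sq_nonneg t]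
    -- the difference is a quadratic in `t` with positive leading coefficient, minimal near this `t`
    nlinarith [sq_nonneg (t - 0.06)]
  · have h2 := le_neg_digammaReal_two_sub (c := 0.938) hs (by nlinarith) le_rfl
    rw [e] at h2
    rw [ht] at h1 h2 ⊢
    have h3 : t ^ 3 ≤ 0 := by nlinarith [sq_nonneg t]
    nlinarith [sq_nonneg (t + 0.03)]

/-! ### Endpoint values and optimality of the line -/

/-- `F` extends continuously to `[0, 1]`, with the pole of `ζ` at `1` cancelling that of `ψ`.
Here `riemannZeta₀ s` is the entire function `ζ(s) + 1 / (1 - s)`. -/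
noncomputable def extendedF (s : ℝ) : ℝ := (riemannZeta₀ s - Complex.digamma (2 - s)).re

lemma F_eq_extendedF {s : ℝ} (hs : s ∈ Ioo (0 : ℝ) 1) : F s = extendedF s := by
  have hs1 : (s : ℂ) ≠ 1 := by exact_mod_cast hs.2.ne
  have h := riemannZeta_eq_inv_sub_add hs1
  have h1 : riemannZeta₀ s = ((zetaReal s + 1 / (1 - s) : ℝ) : ℂ) := by
    rw [riemannZeta_ofReal] at h
    push_cast
    have h2 : (1 : ℂ) / (1 - s) = -(s - 1 : ℂ)⁻¹ := by rw [one_div, ← inv_neg, neg_sub]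
    rw [h, h2]
    ring
  have h2 : Complex.digamma (2 - s) = (digammaReal (2 - s) : ℂ) := by
    rw [← digamma_ofReal (by linarith [hs.2])]
    push_cast
    rfl
  rw [F_eq hs, extendedF, h1, h2, ← Complex.ofReal_sub, Complex.ofReal_re]

lemma continuousAt_extendedF {s : ℝ} (hs : s < 2) : ContinuousAt extendedF s := by
  have hU : IsOpen {z : ℂ | 0 < z.re} := isOpen_lt continuous_const Complex.continuous_re
  have hne (z : ℂ) (hz : 0 < z.re) (m : ℕ) : z ≠ -m := by
    rintro rfl
    have : (0 : ℝ) ≤ m := m.cast_nonneg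
    simp at hz
    linarith
  have hd : DifferentiableOn ℂ Complex.Gamma {z : ℂ | 0 < z.re} := fun z hz ↦
    (Complex.differentiableAt_Gamma z (hne z hz)).differentiableWithinAt
  have hs' : 0 < (2 - (s : ℂ)).re := by simp; linarith
  have hdig : ContinuousAt Complex.digamma (2 - (s : ℂ)) :=
    ((hd.deriv hU).continuousOn.continuousAt (hU.mem_nhds hs')).div
      (hd.continuousOn.continuousAt (hU.mem_nhds hs')) (Complex.Gamma_ne_zero (hne _ hs'))
  have h1 : ContinuousAt (fun x : ℝ ↦ Complex.digamma (2 - (x : ℂ))) s :=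
    ContinuousAt.comp (f := fun x : ℝ ↦ 2 - (x : ℂ)) hdig (by fun_prop)
  have h2 : ContinuousAt (fun x : ℝ ↦ riemannZeta₀ (x : ℂ)) s :=
    (differentiable_riemannZeta₀.continuous.comp Complex.continuous_ofReal).continuousAt
  exact Complex.continuous_re.continuousAt.comp (h2.sub h1)

lemma extendedF_zero : extendedF 0 = intercept := by
  have h0 : riemannZeta₀ ((0 : ℝ) : ℂ) = 1 / 2 := by
    have h := riemannZeta_eq_inv_sub_add (zero_ne_one (α := ℂ))
    rw [riemannZeta_zero] at h
    rw [Complex.ofReal_zero]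
    linear_combination -h + (by norm_num : (0 - 1 : ℂ)⁻¹ = -1)
  have h2 : Complex.digamma (2 - ((0 : ℝ) : ℂ)) = ((-Real.eulerMascheroniConstant + 1 : ℝ) : ℂ) := by
    have := digammaReal_add_one one_pos
    rw [digammaReal_one] at this
    rw [show (2 - ((0 : ℝ) : ℂ)) = ((1 + 1 : ℝ) : ℂ) by push_cast; ring,
      digamma_ofReal (by norm_num), this]
    norm_num
  rw [extendedF, h0, h2, intercept, show (1 / 2 : ℂ) = ((1 / 2 : ℝ) : ℂ) by push_cast; rfl,
    ← Complex.ofReal_sub, Complex.ofReal_re]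
  ring

lemma extendedF_one : extendedF 1 = slope + intercept := by
  rw [extendedF, Complex.ofReal_one, riemannZeta₀_one, show (2 - 1 : ℂ) = 1 by norm_num,
    Complex.digamma_one, slope, intercept, ← Complex.ofReal_neg, ← Complex.ofReal_sub,
    Complex.ofReal_re]
  ring

/-- A linear upper bound `F s ≤ m s + c` passes to the endpoints of `[0, 1]`, where the extension
of `F` agrees with the line `slope * s + intercept`. -/
lemma isBestLinearUpperBound_F : IsBestLinearUpperBound F (Ioo 0 1) slope intercept := by
  refine ⟨fun s hs ↦ (F_lt hs).le, fun m c h s hs ↦ ?_⟩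
  have hcl : ∀ x ∈ Icc (0 : ℝ) 1, extendedF x ≤ m * x + c := by
    have hne : (0 : ℝ) ≠ 1 := zero_ne_one
    rw [← closure_Ioo hne]
    refine fun x hx ↦ le_on_closure (s := Ioo (0 : ℝ) 1) (f := extendedF) (g := fun x ↦ m * x + c)
      (fun y hy ↦ F_eq_extendedF hy ▸ h y hy) (fun y hy ↦ ?_) (by fun_prop) hx
    rw [closure_Ioo hne] at hy
    exact (continuousAt_extendedF (by linarith [hy.2])).continuousWithinAt
  have h0 := hcl 0 (left_mem_Icc.2 zero_le_one)
  have h1 := hcl 1 (right_mem_Icc.2 zero_le_one)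
  rw [extendedF_zero] at h0
  rw [extendedF_one] at h1
  nlinarith [hs.1, hs.2]

end HenryZeta

theorem corollary1p2 :
    -- `ζ` and `ψ` are real-valued on `(0, 1)`
    (∀ s ∈ Ioo (0 : ℝ) 1,
      riemannZeta (s : ℂ) = (HenryZeta.zetaReal s : ℂ) ∧
      Complex.digamma (s : ℂ) = (HenryZeta.digammaReal s : ℂ)) ∧
    -- `s < F(s) < b' s + b`
    (∀ s ∈ Ioo (0 : ℝ) 1,
      s < HenryZeta.F s ∧ HenryZeta.F s < HenryZeta.slope * s + HenryZeta.intercept) ∧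
    -- `b' s + b` is the best possible linear upper bound
    HenryZeta.IsBestLinearUpperBound HenryZeta.F (Ioo 0 1)
      HenryZeta.slope HenryZeta.intercept ∧
    -- the reflection formula and Henry's inequality
    (∀ s ∈ Ioo (0 : ℝ) 1,
      HenryZeta.digammaReal (1 - s) - HenryZeta.digammaReal s
        = Real.pi * Real.cot (Real.pi * s)) ∧
    (∀ s ∈ Ioo (0 : ℝ) 1,
      Real.pi * Real.cot (Real.pi * s) + s
        < HenryZeta.zetaReal s - HenryZeta.digammaReal s ∧
      HenryZeta.zetaReal s - HenryZeta.digammaReal s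
        < Real.pi * Real.cot (Real.pi * s) + HenryZeta.slope * s + HenryZeta.intercept) := by
  refine ⟨fun s hs ↦ ⟨HenryZeta.riemannZeta_ofReal s, HenryZeta.digamma_ofReal hs.1⟩,
    fun s hs ↦ ⟨HenryZeta.lt_F hs, HenryZeta.F_lt hs⟩, HenryZeta.isBestLinearUpperBound_F,
    fun s hs ↦ HenryZeta.digammaReal_one_sub_sub hs, fun s hs ↦ ?_⟩
  have h1 := HenryZeta.lt_F hs
  have h2 := HenryZeta.F_lt hs
  have h3 := HenryZeta.digammaReal_one_sub_sub hs
  rw [HenryZeta.F] at h1 h2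
  constructor <;> linarith
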